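/- For $n\ge 1$ let $\mathbb S^{n-1}=\{z\in\mathbb R^n:\|z\|=1\}$, let $\mu=\mu_n$ be the uniform probability measure on $\mathbb S^{n-1}$, and let $\angle(z,y)=\arccos\langle z,y\rangle$ for $z,y\in\mathbb S^{n-1}$. The spherical cap with pole $z_0\in\mathbb S^{n-1}$ and angle $\theta$ is $\mathrm{Cap}(z_0,\theta)=\{z\in\mathbb S^{n-1}:\angle(z_0,z)\le\theta\}$. A set $A\subseteq\mathbb S^{n-1}$ has effective angle $\theta$ if $\mu(A)=\mu(\mathrm{Cap}(z_0,\theta))$ for some $z_0\in\mathbb S^{n-1}$, and the $\omega$-blowup of $A$ is $$A_\omega=\{x\in\mathbb S^{n-1}:\angle(z,x)\le\omega\text{ for some }z\in A\}.$$ Let $\theta\in(0,\pi/2]$ and $\omega>\pi/2-\theta$, and for every $n\ge 1$ let $A^{(n)}\subseteq\mathbb S^{n-1}$ be an arbitrary set with effective angle $\theta$. Then $$\mu_n\bigl(A^{(n)}_\omega\bigr)\to 1\quad\text{as } n\to\infty.$$ (For sets that are not measurable, $\mu_n$ denotes the outer measure.) -/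

import Mathlib

open MeasureTheory Filter Topology

namespace SphereBlowup

/-- The unit sphere `S^{n-1} = {z ∈ ℝⁿ : ‖z‖ = 1}`, as a type. -/
abbrev Sphere (n : ℕ) : Type :=
  Metric.sphere (0 : EuclideanSpace ℝ (Fin n)) 1

/-- The uniform probability measure on `S^{n-1}`: the surface measure divided by its total mass
(meaningful for `n ≥ 1`). On a set that is not measurable it is the induced outer measure. -/
noncomputable def uniform (n : ℕ) : Measure (Sphere n) :=
  ((volume : Measure (EuclideanSpace ℝ (Fin n))).toSphere Set.univ)⁻¹ •
    (volume : Measure (EuclideanSpace ℝ (Fin n))).toSphere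

/-- The angle (geodesic distance) `∠(z, y) = arccos ⟨z, y⟩` of two points of the sphere. -/
noncomputable def angle {n : ℕ} (z y : Sphere n) : ℝ :=
  Real.arccos (inner ℝ (z : EuclideanSpace ℝ (Fin n)) (y : EuclideanSpace ℝ (Fin n)))

/-- The spherical cap with pole `z₀` and angle `θ`. -/
def cap {n : ℕ} (z₀ : Sphere n) (θ : ℝ) : Set (Sphere n) :=
  {z | angle z₀ z ≤ θ}

/-- `A` has effective angle `θ`: it has the uniform measure of a spherical cap of angle `θ`. -/
def HasEffectiveAngle {n : ℕ} (A : Set (Sphere n)) (θ : ℝ) : Prop :=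
  ∃ z₀ : Sphere n, uniform n A = uniform n (cap z₀ θ)

/-- The `ω`-blowup of `A`: the points of the sphere at angle at most `ω` from some point of `A`. -/
def blowup {n : ℕ} (A : Set (Sphere n)) (ω : ℝ) : Set (Sphere n) :=
  {x | ∃ z ∈ A, angle z x ≤ ω}

end SphereBlowup

/-!
The blowup is controlled by the Brunn–Minkowski inequality, applied to cones over subsets of the
sphere. For `S ⊆ S^{n-1}` let `cone S = {r z : 0 < r < 1, z ∈ S}`; its volume is `μ(S)` times the
volume of the unit ball.

One may assume `ω ≤ π / 2`. Put `κ = cos ω`, so that `0 ≤ κ < sin θ`, and fix `σ` between `κ` and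
`sin θ`. Let `B` be the set of all `x` with `⟨z, x⟩ ≤ κ` for every `z ∈ A`. The complement of `B`
lies in the blowup, so it suffices that `μ(B) → 0`. For `x` in the cone over the closure of `A` and
`y ∈ cone B`, the point `p σ⁻¹ x + (1 - p) y` has norm at most `R`, where
`R² = (p / σ)² + (1 - p)² + 2 (p / σ) (1 - p) κ = 1 - 2 p (1 - κ / σ) + O(p²)`, so that `R < 1` for
small `p`. The Brunn–Minkowski inequality in its multiplicative form yields
`(μ(closure A) / σⁿ)ᵖ μ(B)¹⁻ᵖ ≤ Rⁿ` (`uniform_rpow_mul_uniform_rpow_le`). Since `A` has effective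
angle `θ` and a cap of angle `θ` has measure at least `c σⁿ` (`exists_le_uniform_cap`), it follows
that `μ(B)¹⁻ᵖ ≤ Rⁿ / cᵖ → 0`. Passing to the closure also disposes of non-measurable `A`.

The Brunn–Minkowski inequality (`volume_rpow_mul_volume_rpow_le`) is the case of indicator functions
in the Prékopa–Leindler inequality (`prekopaLeindler`), which reduces by Fubini to dimension one;
there it follows from the inequality `|C| + |D| ≤ |C + D|` for superlevel sets.
-/

namespace SphereBlowup

open Set
open scoped ENNReal Pointwise

/-! ### The Prékopa–Leindler and Brunn–Minkowski inequalities -/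

/-- The one-dimensional Brunn–Minkowski inequality, without dilations. For compact `K`, `L`, the
translates of `K` by `min L` and of `L` by `max K` share a single point. -/
lemma volume_add_volume_le_of_add_subset {C D E : Set ℝ} (hC : MeasurableSet C)
    (hD : MeasurableSet D) (hC₀ : C.Nonempty) (hD₀ : D.Nonempty) (h : C + D ⊆ E) :
    volume C + volume D ≤ volume E := by
  have hK : ∀ K ⊆ C, IsCompact K → ∀ L ⊆ D, IsCompact L → volume K + volume L ≤ volume E := by
    intro K hKC hK L hLD hL
    rcases K.eq_empty_or_nonempty with rfl | hK₀
    · obtain ⟨c, hc⟩ := hC₀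
      have : c +ᵥ L ⊆ E := by
        rintro _ ⟨y, hy, rfl⟩
        exact h (add_mem_add hc (hLD hy))
      simpa using measure_mono (μ := volume) this
    rcases L.eq_empty_or_nonempty with rfl | hL₀
    · obtain ⟨d, hd⟩ := hD₀
      have : d +ᵥ K ⊆ E := by
        rintro _ ⟨y, hy, rfl⟩
        exact h (by simpa [add_comm] using add_mem_add (hKC hy) hd)
      simpa using measure_mono (μ := volume) this
    obtain ⟨k, hkK, hk⟩ := hK.exists_isGreatest hK₀
    obtain ⟨l, hlL, hl⟩ := hL.exists_isLeast hL₀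
    have hsub : (l +ᵥ K) ∪ (k +ᵥ L) ⊆ E := by
      rintro _ (⟨y, hy, rfl⟩ | ⟨y, hy, rfl⟩)
      · exact h (by simpa [add_comm] using add_mem_add (hKC hy) (hLD hlL))
      · exact h (add_mem_add (hKC hkK) (hLD hy))
    have hdisj : AEDisjoint volume (l +ᵥ K) (k +ᵥ L) := by
      refine measure_mono_null (t := {k + l}) ?_ (by simp)
      rintro _ ⟨⟨x, hx, rfl⟩, ⟨y, hy, hxy⟩⟩
      have h1 := hk hx
      have h2 := hl hy
      simp only [vadd_eq_add, mem_singleton_iff] at hxy ⊢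
      linarith
    calc volume K + volume L = volume (l +ᵥ K) + volume (k +ᵥ L) := by simp
      _ = volume ((l +ᵥ K) ∪ (k +ᵥ L)) :=
        (measure_union₀ (hL.vadd k).measurableSet.nullMeasurableSet hdisj).symm
      _ ≤ volume E := measure_mono hsub
  simp only [hC.measure_eq_iSup_isCompact, hD.measure_eq_iSup_isCompact, iSup_and']
  exact ENNReal.biSup_add_biSup_le' ⟨∅, empty_subset _, isCompact_empty⟩
    ⟨∅, empty_subset _, isCompact_empty⟩ fun K hK' L hL' => hK K hK'.1 hK'.2 L hL'.1 hL'.2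

/-- The one-dimensional Brunn–Minkowski inequality. -/
lemma mul_volume_add_mul_volume_le {a b : ℝ} (ha : 0 < a) (hb : 0 < b) {C D E : Set ℝ}
    (hC : MeasurableSet C) (hD : MeasurableSet D) (hC₀ : C.Nonempty) (hD₀ : D.Nonempty)
    (h : ∀ x ∈ C, ∀ y ∈ D, a * x + b * y ∈ E) :
    ENNReal.ofReal a * volume C + ENNReal.ofReal b * volume D ≤ volume E := by
  have := volume_add_volume_le_of_add_subset (E := E) (hC.const_smul₀ a) (hD.const_smul₀ b)
    (hC₀.smul_set) (hD₀.smul_set) (by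
      rintro _ ⟨_, ⟨x, hx, rfl⟩, _, ⟨y, hy, rfl⟩, rfl⟩
      exact h x hx y hy)
  simpa [Measure.addHaar_smul, abs_of_pos ha, abs_of_pos hb] using this

/-- The weighted inequality of the arithmetic and geometric means in `ℝ≥0∞`. -/
lemma rpow_mul_rpow_le_add {a b : ℝ} (ha : 0 < a) (hb : 0 < b) (hab : a + b = 1) (x y : ℝ≥0∞) :
    x ^ a * y ^ b ≤ ENNReal.ofReal a * x + ENNReal.ofReal b * y := by
  have hpq : (a⁻¹).HolderConjugate b⁻¹ := by
    rw [Real.holderConjugate_iff]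
    refine ⟨(one_lt_inv₀ ha).2 (by linarith), by simpa using hab⟩
  have := ENNReal.young_inequality (x ^ a) (y ^ b) hpq
  rwa [ENNReal.rpow_rpow_inv ha.ne', ENNReal.rpow_rpow_inv hb.ne', ENNReal.ofReal_inv_of_pos ha,
    ENNReal.ofReal_inv_of_pos hb, div_eq_mul_inv, div_eq_mul_inv, inv_inv, inv_inv, mul_comm x,
    mul_comm y] at this

/-- The layer cake formula for functions bounded by `1`. -/
lemma lintegral_eq_lintegral_Ioo_volume_lt {f : ℝ → ℝ≥0∞} (hf : Measurable f)
    (hf₁ : ∀ x, f x ≤ 1) :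
    ∫⁻ x, f x = ∫⁻ t in Ioo (0 : ℝ) 1, volume {x | ENNReal.ofReal t < f x} := by
  have hfin : ∀ x, f x ≠ ∞ := fun x => ((hf₁ x).trans_lt ENNReal.one_lt_top).ne
  have key := lintegral_eq_lintegral_meas_lt volume (f := fun x => (f x).toReal)
    (Eventually.of_forall fun x => ENNReal.toReal_nonneg) hf.ennreal_toReal.aemeasurable
  simp only [ENNReal.ofReal_toReal (hfin _)] at key
  rw [key, ← lintegral_indicator measurableSet_Ioi, ← lintegral_indicator measurableSet_Ioo]
  congr 1 with t
  by_cases ht : 0 < t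
  · by_cases ht1 : t < 1
    · simp only [indicator, mem_Ioi, ht, mem_Ioo, ht1, and_self, if_true,
        ENNReal.ofReal_lt_iff_lt_toReal ht.le (hfin _)]
    · have : {x | t < (f x).toReal} = ∅ := by
        ext x
        simp only [mem_ofPred_eq, mem_empty_iff_false, iff_false, not_lt]
        exact (ENNReal.toReal_mono ENNReal.one_ne_top (hf₁ x)).trans (by simpa using ht1)
      simp [indicator, ht, ht1, this]
  · simp [indicator, ht]

/-- The one-dimensional Prékopa–Leindler inequality in its arithmetic form, for functions with
supremum `1`: the superlevel sets at every height below `1` are nonempty, so that the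
Brunn–Minkowski inequality applies to each of them. -/
lemma mul_lintegral_add_mul_lintegral_le {a b : ℝ} (ha : 0 < a) (hb : 0 < b) (hab : a + b = 1)
    {f g h : ℝ → ℝ≥0∞} (hf : Measurable f) (hg : Measurable g) (hh : Measurable h)
    (hf₁ : ⨆ x, f x = 1) (hg₁ : ⨆ x, g x = 1)
    (hfgh : ∀ x y, f x ^ a * g y ^ b ≤ h (a * x + b * y)) :
    ENNReal.ofReal a * (∫⁻ x, f x) + ENNReal.ofReal b * (∫⁻ x, g x) ≤ ∫⁻ x, h x := by
  have hf₁' : ∀ x, f x ≤ 1 := fun x => hf₁ ▸ le_iSup f x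
  have hg₁' : ∀ x, g x ≤ 1 := fun x => hg₁ ▸ le_iSup g x
  calc ENNReal.ofReal a * (∫⁻ x, f x) + ENNReal.ofReal b * (∫⁻ x, g x)
      = ∫⁻ t in Ioo (0 : ℝ) 1, (ENNReal.ofReal a * volume {x | ENNReal.ofReal t < f x} +
          ENNReal.ofReal b * volume {x | ENNReal.ofReal t < g x}) := by
        have hm : ∀ u : ℝ → ℝ≥0∞, Measurable fun t : ℝ => volume {x | ENNReal.ofReal t < u x} :=
          fun u => Antitone.measurable fun s t hst => measure_mono fun x hx =>
            (ENNReal.ofReal_le_ofReal hst).trans_lt hx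
        rw [lintegral_eq_lintegral_Ioo_volume_lt hf hf₁',
          lintegral_eq_lintegral_Ioo_volume_lt hg hg₁', lintegral_add_left ((hm f).const_mul _),
          lintegral_const_mul _ (hm f), lintegral_const_mul _ (hm g)]
    -- Truncating `h` at `1` loses nothing at these heights and keeps it finite for the layer cake.
    _ ≤ ∫⁻ t in Ioo (0 : ℝ) 1, volume {x | ENNReal.ofReal t < min (h x) 1} := by
        refine setLIntegral_mono' measurableSet_Ioo fun t ht => ?_
        have ht1 : ENNReal.ofReal t < 1 := by simpa using ht.2
        refine mul_volume_add_mul_volume_le ha hb (measurableSet_lt measurable_const hf)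
          (measurableSet_lt measurable_const hg) (lt_iSup_iff.1 (ht1.trans_eq hf₁.symm))
          (lt_iSup_iff.1 (ht1.trans_eq hg₁.symm)) fun x hx y hy => lt_min ?_ ht1
        calc ENNReal.ofReal t = ENNReal.ofReal t ^ a * ENNReal.ofReal t ^ b := by
              rw [← ENNReal.rpow_add_of_nonneg _ _ ha.le hb.le, hab, ENNReal.rpow_one]
          _ < f x ^ a * g y ^ b :=
              ENNReal.mul_lt_mul (ENNReal.rpow_lt_rpow hx ha) (ENNReal.rpow_lt_rpow hy hb)
          _ ≤ _ := hfgh x y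
    _ = ∫⁻ x, min (h x) 1 :=
        (lintegral_eq_lintegral_Ioo_volume_lt (hh.min measurable_const)
          fun x => min_le_right _ _).symm
    _ ≤ ∫⁻ x, h x := lintegral_mono fun x => min_le_left _ _

/-- For bounded functions, dividing `f` and `g` by their suprema `M` and `N`, and `h` by
`M ^ a * N ^ b`, reduces the inequality to the arithmetic form. -/
lemma prekopaLeindler_real_of_bounded {a b : ℝ} (ha : 0 < a) (hb : 0 < b) (hab : a + b = 1)
    {f g h : ℝ → ℝ≥0∞} (hf : Measurable f) (hg : Measurable g) (hh : Measurable h)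
    (hf_top : ⨆ x, f x ≠ ∞) (hg_top : ⨆ x, g x ≠ ∞)
    (hfgh : ∀ x y, f x ^ a * g y ^ b ≤ h (a * x + b * y)) :
    (∫⁻ x, f x) ^ a * (∫⁻ x, g x) ^ b ≤ ∫⁻ x, h x := by
  set M := ⨆ x, f x with hM
  set N := ⨆ x, g x with hN
  by_cases hM0 : M = 0
  · have : ∀ x, f x = 0 := by simpa [hM] using hM0
    simp [this, ENNReal.zero_rpow_of_pos ha]
  by_cases hN0 : N = 0
  · have : ∀ x, g x = 0 := by simpa [hN] using hN0
    simp [this, ENNReal.zero_rpow_of_pos hb]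
  set c := M ^ a * N ^ b with hc
  have hc0 : c ≠ 0 := mul_ne_zero (by simp [hM0, hf_top]) (by simp [hN0, hg_top])
  have hcT : c ≠ ∞ := ENNReal.mul_ne_top (ENNReal.rpow_ne_top_of_nonneg ha.le hf_top)
    (ENNReal.rpow_ne_top_of_nonneg hb.le hg_top)
  have hinv : c⁻¹ = M⁻¹ ^ a * N⁻¹ ^ b := by
    rw [hc, ENNReal.mul_inv (by simp [hM0, hf_top]) (by simp [hN0, hg_top]), ENNReal.inv_rpow,
      ENNReal.inv_rpow]
  have key := mul_lintegral_add_mul_lintegral_le ha hb hab (hf.const_mul M⁻¹) (hg.const_mul N⁻¹)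
    (hh.const_mul c⁻¹) (by rw [← ENNReal.mul_iSup, ENNReal.inv_mul_cancel hM0 hf_top])
    (by rw [← ENNReal.mul_iSup, ENNReal.inv_mul_cancel hN0 hg_top]) (fun x y => by
      rw [ENNReal.mul_rpow_of_nonneg _ _ ha.le, ENNReal.mul_rpow_of_nonneg _ _ hb.le,
        mul_mul_mul_comm, ← hinv]
      gcongr
      exact hfgh x y)
  have := (rpow_mul_rpow_le_add ha hb hab _ _).trans key
  rw [lintegral_const_mul _ hf, lintegral_const_mul _ hg, lintegral_const_mul _ hh,
    ENNReal.mul_rpow_of_nonneg _ _ ha.le, ENNReal.mul_rpow_of_nonneg _ _ hb.le,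
    mul_mul_mul_comm, ← hinv] at this
  exact (ENNReal.mul_le_mul_iff_right (ENNReal.inv_ne_zero.2 hcT) (ENNReal.inv_ne_top.2 hc0)).1 this

/-- The one-dimensional Prékopa–Leindler inequality, by truncating `f` and `g` at height `k`. -/
lemma prekopaLeindler_real {a b : ℝ} (ha : 0 < a) (hb : 0 < b) (hab : a + b = 1)
    {f g h : ℝ → ℝ≥0∞} (hf : Measurable f) (hg : Measurable g) (hh : Measurable h)
    (hfgh : ∀ x y, f x ^ a * g y ^ b ≤ h (a * x + b * y)) :
    (∫⁻ x, f x) ^ a * (∫⁻ x, g x) ^ b ≤ ∫⁻ x, h x := by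
  by_cases hf0 : ∫⁻ x, f x = 0
  · simp [hf0, ENNReal.zero_rpow_of_pos ha]
  by_cases hg0 : ∫⁻ x, g x = 0
  · simp [hg0, ENNReal.zero_rpow_of_pos hb]
  have hlim : ∀ u : ℝ → ℝ≥0∞, Measurable u →
      Tendsto (fun k : ℕ => ∫⁻ x, min (u x) k) atTop (𝓝 (∫⁻ x, u x)) := fun u hu => by
    refine lintegral_tendsto_of_tendsto_of_monotone
      (fun k => (hu.min measurable_const).aemeasurable)
      (Eventually.of_forall fun x m n hmn => min_le_min_left _ (Nat.cast_le.2 hmn))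
      (Eventually.of_forall fun x => ?_)
    simpa using (tendsto_const_nhds (x := u x)).min ENNReal.tendsto_nat_nhds_top
  refine le_of_tendsto (ENNReal.Tendsto.mul
    ((ENNReal.continuous_rpow_const (y := a)).tendsto _ |>.comp (hlim f hf)) ?_
    ((ENNReal.continuous_rpow_const (y := b)).tendsto _ |>.comp (hlim g hg)) ?_)
    (Eventually.of_forall fun k => ?_)
  · exact Or.inl (by simp [hf0, ha.not_gt])
  · exact Or.inl (by simp [hg0, hb.not_gt])
  · have hbd : ∀ u : ℝ → ℝ≥0∞, ⨆ x, min (u x) (k : ℝ≥0∞) ≠ ∞ := fun u =>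
      ((iSup_le fun x => min_le_right _ _).trans_lt (ENNReal.natCast_lt_top k)).ne
    refine prekopaLeindler_real_of_bounded ha hb hab (hf.min measurable_const)
      (hg.min measurable_const) hh (hbd f) (hbd g) fun x y => le_trans ?_ (hfgh x y)
    gcongr <;> exact min_le_left _ _

/-- The Prékopa–Leindler inequality on `ℝⁿ`, by induction on `n`: the integrals over the last
`n` coordinates satisfy the one-dimensional hypothesis in the first one. -/
lemma prekopaLeindler {a b : ℝ} (ha : 0 < a) (hb : 0 < b) (hab : a + b = 1) (n : ℕ)
    {f g h : (Fin n → ℝ) → ℝ≥0∞} (hf : Measurable f) (hg : Measurable g) (hh : Measurable h)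
    (hfgh : ∀ x y, f x ^ a * g y ^ b ≤ h (a • x + b • y)) :
    (∫⁻ x, f x) ^ a * (∫⁻ x, g x) ^ b ≤ ∫⁻ x, h x := by
  induction n with
  | zero =>
    have hvol : (volume : Measure (Fin 0 → ℝ)) univ = 1 := by simp [volume_pi]
    have := hfgh default default
    rw [Subsingleton.elim (a • (default : Fin 0 → ℝ) + b • (default : Fin 0 → ℝ)) default] at this
    simp only [lintegral_unique, hvol, mul_one]
    convert this
  | succ n ih =>
    let e := (MeasurableEquiv.piFinSuccAbove (fun _ : Fin (n + 1) => ℝ) 0).symm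
    have he : ∀ x y x' y', a • e (x, y) + b • e (x', y') = e (a * x + b * x', a • y + b • y') := by
      intro x y x' y'
      ext i
      refine Fin.cases ?_ (fun j => ?_) i <;>
        simp [e, MeasurableEquiv.piFinSuccAbove_symm_apply]
    have hint : ∀ u : (Fin (n + 1) → ℝ) → ℝ≥0∞, Measurable u →
        ∫⁻ x, u x = ∫⁻ x : ℝ, ∫⁻ y : Fin n → ℝ, u (e (x, y)) := by
      intro u hu
      rw [← lintegral_prod (fun p => u (e p)) (hu.comp e.measurable).aemeasurable]
      exact MeasurePreserving.lintegral_map_equiv u e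
        (volume_preserving_piFinSuccAbove (fun _ : Fin (n + 1) => ℝ) 0).symm
    have hmeas : ∀ u : (Fin (n + 1) → ℝ) → ℝ≥0∞, Measurable u →
        Measurable fun x : ℝ => ∫⁻ y : Fin n → ℝ, u (e (x, y)) := fun u hu =>
      (hu.comp e.measurable).lintegral_prod_right'
    rw [hint f hf, hint g hg, hint h hh]
    refine prekopaLeindler_real ha hb hab (hmeas f hf) (hmeas g hg) (hmeas h hh) fun x x' => ?_
    have hsec : ∀ (u : (Fin (n + 1) → ℝ) → ℝ≥0∞) (x : ℝ), Measurable u →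
        Measurable fun y : Fin n → ℝ => u (e (x, y)) := fun u x hu =>
      hu.comp (e.measurable.comp measurable_prodMk_left)
    refine ih (hsec f x hf) (hsec g x' hg) (hsec h _ hh) fun y y' => ?_
    rw [← he]
    exact hfgh _ _

/-- The multiplicative form of the Brunn–Minkowski inequality. -/
lemma volume_rpow_mul_volume_rpow_le {a b : ℝ} (ha : 0 < a) (hb : 0 < b) (hab : a + b = 1) {n : ℕ}
    {K L E : Set (EuclideanSpace ℝ (Fin n))} (hK : MeasurableSet K) (hL : MeasurableSet L)
    (hE : MeasurableSet E) (h : ∀ x ∈ K, ∀ y ∈ L, a • x + b • y ∈ E) :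
    volume K ^ a * volume L ^ b ≤ volume E := by
  have hT := PiLp.volume_preserving_toLp (Fin n)
  have hvol : ∀ S : Set (EuclideanSpace ℝ (Fin n)), MeasurableSet S →
      ∫⁻ x : Fin n → ℝ, S.indicator 1 (WithLp.toLp 2 x) = volume S := fun S hS => by
    rw [hT.lintegral_comp (measurable_one.indicator hS), lintegral_indicator_one hS]
  have hm : ∀ S : Set (EuclideanSpace ℝ (Fin n)), MeasurableSet S →
      Measurable fun x : Fin n → ℝ => S.indicator (1 : EuclideanSpace ℝ (Fin n) → ℝ≥0∞) (WithLp.toLp 2 x) :=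
    fun S hS => (measurable_one.indicator hS).comp hT.measurable
  rw [← hvol K hK, ← hvol L hL, ← hvol E hE]
  refine prekopaLeindler ha hb hab n (hm K hK) (hm L hL) (hm E hE) fun x y => ?_
  by_cases hx : WithLp.toLp 2 x ∈ K
  · by_cases hy : WithLp.toLp 2 y ∈ L
    · simp [hx, hy, h _ hx _ hy]
    · simp [hy, ENNReal.zero_rpow_of_pos hb]
  · simp [hx, ENNReal.zero_rpow_of_pos ha]

/-! ### Cones over subsets of the sphere -/

/-- The truncated open cone `{r z : 0 < r < 1, z ∈ S}` over a subset `S` of the sphere. -/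
def cone {n : ℕ} (S : Set (Sphere n)) : Set (EuclideanSpace ℝ (Fin n)) :=
  Ioo (0 : ℝ) 1 • ((↑) '' S)

lemma mem_cone {n : ℕ} {S : Set (Sphere n)} {x : EuclideanSpace ℝ (Fin n)} :
    x ∈ cone S ↔ ∃ r : ℝ, 0 < r ∧ r < 1 ∧ ∃ z ∈ S, x = r • (z : EuclideanSpace ℝ (Fin n)) := by
  simp only [cone, Set.mem_smul, mem_Ioo, mem_image]
  constructor
  · rintro ⟨r, ⟨h0, h1⟩, _, ⟨z, hz, rfl⟩, rfl⟩
    exact ⟨r, h0, h1, z, hz, rfl⟩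
  · rintro ⟨r, h0, h1, z, hz, rfl⟩
    exact ⟨r, ⟨h0, h1⟩, _, ⟨z, hz, rfl⟩, rfl⟩

lemma measurableSet_cone {n : ℕ} {S : Set (Sphere n)} (hS : MeasurableSet S) :
    MeasurableSet (cone S) := by
  have hS' : MeasurableSet (((↑) : Sphere n → EuclideanSpace ℝ (Fin n)) '' S) :=
    Metric.isClosed_sphere.measurableSet.subtype_image hS
  have : cone S = Metric.ball 0 1 ∩
      (fun x : EuclideanSpace ℝ (Fin n) => ‖x‖⁻¹ • x) ⁻¹' ((↑) '' S) := by
    ext x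
    rw [mem_cone]
    constructor
    · rintro ⟨r, h0, h1, z, hz, rfl⟩
      have hr : ‖r • (z : EuclideanSpace ℝ (Fin n))‖ = r := by
        simp [norm_smul, abs_of_pos h0]
      refine ⟨by simpa [hr] using h1, z, hz, ?_⟩
      simp only [hr, smul_smul, inv_mul_cancel₀ h0.ne', one_smul]
    · rintro ⟨hx, z, hz, hzx⟩
      have h0 : ‖x‖ ≠ 0 := fun h => by
        have := norm_eq_of_mem_sphere z
        simp [hzx, h] at this
      refine ⟨‖x‖, lt_of_le_of_ne (norm_nonneg _) h0.symm, by simpa using hx, z, hz, ?_⟩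
      rw [hzx, smul_smul, mul_inv_cancel₀ h0, one_smul]
  rw [this]
  exact Metric.isOpen_ball.measurableSet.inter ((measurable_norm.inv.smul measurable_id) hS')

lemma volume_ball_ne_zero (n : ℕ) :
    volume (Metric.ball (0 : EuclideanSpace ℝ (Fin n)) 1) ≠ 0 :=
  (Metric.measure_ball_pos _ _ one_pos).ne'

lemma volume_ball_ne_top (n : ℕ) :
    volume (Metric.ball (0 : EuclideanSpace ℝ (Fin n)) 1) ≠ ∞ :=
  measure_ball_lt_top.ne

lemma uniform_apply {n : ℕ} (hn : 1 ≤ n) {S : Set (Sphere n)} (hS : MeasurableSet S) :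
    uniform n S = volume (cone S) / volume (Metric.ball (0 : EuclideanSpace ℝ (Fin n)) 1) := by
  have hn0 : (n : ℝ≥0∞) ≠ 0 := by simp; omega
  rw [uniform, Measure.smul_apply, smul_eq_mul, Measure.toSphere_apply_univ,
    Measure.toSphere_apply' _ hS, mul_comm, ← div_eq_mul_inv, finrank_euclideanSpace_fin,
    ENNReal.mul_div_mul_left _ _ hn0 (ENNReal.natCast_ne_top n), cone]

lemma isProbabilityMeasure_uniform {n : ℕ} (hn : 1 ≤ n) : IsProbabilityMeasure (uniform n) := by
  constructor
  have hn0 : (n : ℝ≥0∞) ≠ 0 := by simp; omega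
  rw [uniform, Measure.smul_apply, smul_eq_mul, ENNReal.inv_mul_cancel] <;>
    rw [Measure.toSphere_apply_univ, finrank_euclideanSpace_fin]
  · exact mul_ne_zero hn0 (volume_ball_ne_zero n)
  · exact ENNReal.mul_ne_top (ENNReal.natCast_ne_top n) (volume_ball_ne_top n)

lemma volume_cone {n : ℕ} (hn : 1 ≤ n) {S : Set (Sphere n)} (hS : MeasurableSet S) :
    volume (cone S) = uniform n S * volume (Metric.ball (0 : EuclideanSpace ℝ (Fin n)) 1) := by
  rw [uniform_apply hn hS, ENNReal.div_mul_cancel (volume_ball_ne_zero n) (volume_ball_ne_top n)]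

lemma volume_closedBall (n : ℕ) {r : ℝ} (hr : 0 ≤ r) :
    volume (Metric.closedBall (0 : EuclideanSpace ℝ (Fin n)) r) =
      ENNReal.ofReal r ^ n * volume (Metric.ball (0 : EuclideanSpace ℝ (Fin n)) 1) := by
  rw [Measure.addHaar_closedBall _ _ hr, finrank_euclideanSpace_fin, ENNReal.ofReal_pow hr]

/-! ### A two-set inequality on the sphere -/

/-- A two-set isoperimetric inequality: any two points of `S` and `T` have inner product at most
`κ`, so the combinations `p σ⁻¹ x + (1 - p) y` with `x ∈ cone S` and `y ∈ cone T` stay in a ball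
whose radius is explicit, and the Brunn–Minkowski inequality bounds its volume from below. -/
lemma uniform_rpow_mul_uniform_rpow_le {n : ℕ} (hn : 1 ≤ n) {S T : Set (Sphere n)}
    (hS : MeasurableSet S) (hT : MeasurableSet T) {κ σ p : ℝ} (hκ : 0 ≤ κ) (hσ : 0 < σ)
    (hp₀ : 0 < p) (hp₁ : p < 1)
    (hST : ∀ z ∈ S, ∀ w ∈ T,
      inner ℝ (z : EuclideanSpace ℝ (Fin n)) (w : EuclideanSpace ℝ (Fin n)) ≤ κ) :
    (uniform n S / ENNReal.ofReal σ ^ n) ^ p * uniform n T ^ (1 - p) ≤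
      ENNReal.ofReal √((p / σ) ^ 2 + (1 - p) ^ 2 + 2 * (p / σ) * (1 - p) * κ) ^ n := by
  set V := volume (Metric.ball (0 : EuclideanSpace ℝ (Fin n)) 1) with hV
  have hp₁' : 0 < 1 - p := by linarith
  have hs : 0 < p / σ := div_pos hp₀ hσ
  set R := √((p / σ) ^ 2 + (1 - p) ^ 2 + 2 * (p / σ) * (1 - p) * κ) with hR
  have key := volume_rpow_mul_volume_rpow_le (n := n) hp₀ hp₁' (by ring)
    ((measurableSet_cone hS).const_smul₀ σ⁻¹) (measurableSet_cone hT)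
    (Metric.isClosed_closedBall (x := 0) (ε := R)).measurableSet (by
      rintro _ ⟨x, hx, rfl⟩ y hy
      obtain ⟨r, hr0, hr1, z, hz, rfl⟩ := mem_cone.1 hx
      obtain ⟨q, hq0, hq1, w, hw, rfl⟩ := mem_cone.1 hy
      rw [mem_closedBall_zero_iff]
      refine Real.le_sqrt_of_sq_le ?_
      simp only [smul_smul]
      rw [norm_add_sq_real, norm_smul, norm_smul, norm_eq_of_mem_sphere, norm_eq_of_mem_sphere,
        inner_smul_left, inner_smul_right, mul_one, mul_one, Real.norm_eq_abs, Real.norm_eq_abs,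
        sq_abs, sq_abs, show p * (σ⁻¹ * r) = p / σ * r by ring]
      have hrq : r * q ≤ 1 := mul_le_one₀ hr1.le hq0.le hq1.le
      have hin : r * q * inner ℝ (z : EuclideanSpace ℝ (Fin n)) (w : EuclideanSpace ℝ (Fin n))
          ≤ κ :=
        (mul_le_mul_of_nonneg_left (hST z hz w hw) (by positivity)).trans
          (mul_le_of_le_one_left hκ hrq)
      have h1 : (p / σ * r) ^ 2 ≤ (p / σ) ^ 2 :=
        pow_le_pow_left₀ (by positivity) (mul_le_of_le_one_right hs.le hr1.le) 2
      have h2 : ((1 - p) * q) ^ 2 ≤ (1 - p) ^ 2 :=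
        pow_le_pow_left₀ (by positivity) (mul_le_of_le_one_right hp₁'.le hq1.le) 2
      have h3 := mul_le_mul_of_nonneg_left hin (show 0 ≤ 2 * (p / σ) * (1 - p) by positivity)
      simp only [conj_trivial]
      linarith)
  rw [Measure.addHaar_smul, volume_cone hn hS, volume_cone hn hT,
    volume_closedBall n (Real.sqrt_nonneg _), finrank_euclideanSpace_fin,
    abs_of_pos (by positivity), ENNReal.ofReal_pow (by positivity), ENNReal.ofReal_inv_of_pos hσ,
    ← ENNReal.inv_pow, ← mul_assoc, ← ENNReal.div_eq_inv_mul, ENNReal.mul_rpow_of_nonneg _ V hp₀.le,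
    ENNReal.mul_rpow_of_nonneg _ V hp₁'.le, mul_mul_mul_comm,
    ← ENNReal.rpow_add_of_nonneg _ _ hp₀.le hp₁'.le, add_sub_cancel, ENNReal.rpow_one] at key
  exact (ENNReal.mul_le_mul_iff_left (volume_ball_ne_zero n) (volume_ball_ne_top n)).1 key

/-! ### A lower bound for the measure of a cap -/

/-- Among the slabs of width `ε` orthogonal to `u`, those that touch the center of the ball carry
the largest part of its volume: the slab at distance `k ε` is translated by `-k ε u` into the
central one, and this shrinks the norm. -/
lemma volume_closedBall_le_slab {n : ℕ} {u : EuclideanSpace ℝ (Fin n)} (hu : ‖u‖ = 1) {σ ε : ℝ}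
    (hε : 0 < ε) {N : ℕ} (hN : σ < N * ε) :
    volume (Metric.closedBall (0 : EuclideanSpace ℝ (Fin n)) σ) ≤
      2 * N * volume {y : EuclideanSpace ℝ (Fin n) |
        ‖y‖ ≤ σ ∧ 0 ≤ inner ℝ u y ∧ inner ℝ u y ≤ ε} := by
  set Q := {y : EuclideanSpace ℝ (Fin n) | ‖y‖ ≤ σ ∧ 0 ≤ inner ℝ u y ∧ inner ℝ u y ≤ ε} with hQ
  set H := {y : EuclideanSpace ℝ (Fin n) | ‖y‖ ≤ σ ∧ 0 ≤ inner ℝ u y} with hH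
  have huu : inner ℝ u u = (1 : ℝ) := by simp [hu]
  have hHQ : H ⊆ ⋃ k ∈ Finset.range N, ((k * ε) • u) +ᵥ Q := by
    rintro y ⟨hy, hy0⟩
    set t : ℝ := inner ℝ u y with ht
    have htσ : t ≤ σ := by
      have := real_inner_le_norm u y
      rw [hu, one_mul] at this
      exact this.trans hy
    set k := ⌊t / ε⌋₊ with hk
    have hk1 : k * ε ≤ t := (le_div_iff₀ hε).1 (Nat.floor_le (div_nonneg hy0 hε.le))
    have hk2 : t < (k + 1) * ε := (div_lt_iff₀ hε).1 (Nat.lt_floor_add_one _)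
    have hkN : k < N := by
      have : (k : ℝ) < N := lt_of_mul_lt_mul_right (by linarith) hε.le
      exact_mod_cast this
    refine mem_biUnion (Finset.mem_coe.2 (Finset.mem_range.2 hkN))
      ⟨y - (k * ε) • u, ⟨?_, ?_, ?_⟩, by simp⟩
    -- `‖y - k ε u‖² = ‖y‖² - k ε (2 t - k ε)` with `t ≥ k ε`.
    · refine le_trans (abs_le_of_sq_le_sq' ?_ (norm_nonneg y)).2 hy
      rw [norm_sub_sq_real, inner_smul_right, real_inner_comm, norm_smul, hu, mul_one,
        Real.norm_eq_abs, sq_abs, ← ht]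
      nlinarith [mul_nonneg (Nat.cast_nonneg (α := ℝ) k) hε.le]
    · rw [inner_sub_right, inner_smul_right, huu]
      linarith
    · rw [inner_sub_right, inner_smul_right, huu]
      linarith
  have hHvol : volume H ≤ N * volume Q := by
    refine (measure_mono hHQ).trans ((measure_biUnion_finset_le _ _).trans ?_)
    simp
  have hball : Metric.closedBall (0 : EuclideanSpace ℝ (Fin n)) σ ⊆ H ∪ -H := by
    intro y hy
    rw [mem_closedBall_zero_iff] at hy
    rcases le_total 0 (inner ℝ u y) with h | h
    · exact Or.inl ⟨hy, h⟩
    · exact Or.inr ⟨by simpa using hy, by simpa using h⟩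
  calc _ ≤ volume H + volume (-H) := (measure_mono hball).trans (measure_union_le _ _)
    _ = 2 * volume H := by rw [Measure.measure_neg, two_mul]
    _ ≤ 2 * N * volume Q := by rw [mul_assoc]; gcongr

lemma isClosed_cap {n : ℕ} (z₀ : Sphere n) (θ : ℝ) : IsClosed (cap z₀ θ) := by
  refine isClosed_le (Real.continuous_arccos.comp ?_) continuous_const
  fun_prop

/-- A cap of angle `θ` has measure at least `c σⁿ` for every `σ < sin θ`: the cone over it contains
the part of the ball of radius `σ` around `(cos θ) z₀` that lies in a thin slab above the base of
the cap. -/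
lemma exists_le_uniform_cap {θ σ : ℝ} (hθ₀ : 0 < θ) (hθ₁ : θ ≤ Real.pi / 2) (hσ₀ : 0 < σ)
    (hσ : σ < Real.sin θ) :
    ∃ c : ℝ≥0∞, c ≠ 0 ∧ c ≠ ∞ ∧ ∀ n : ℕ, 1 ≤ n → ∀ z₀ : Sphere n,
      ENNReal.ofReal σ ^ n * c ≤ uniform n (cap z₀ θ) := by
  have ha : 0 ≤ Real.cos θ := Real.cos_nonneg_of_mem_Icc ⟨by linarith, hθ₁⟩
  have ha1 := Real.cos_le_one θ
  have hsc := Real.sin_sq_add_cos_sq θ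
  -- The width makes `cos θ ^ 2 + 2 * ε + σ ^ 2 < 1`, so that the slab stays in the unit ball.
  set ε := (Real.sin θ ^ 2 - σ ^ 2) / 4 with hεdef
  have hε : 0 < ε := by
    have : σ ^ 2 < Real.sin θ ^ 2 := pow_lt_pow_left₀ hσ hσ₀.le two_ne_zero
    rw [hεdef]
    linarith
  obtain ⟨N, hN⟩ := exists_nat_gt (σ / ε)
  rw [div_lt_iff₀ hε] at hN
  have hN0 : (N : ℝ≥0∞) ≠ 0 := by
    rintro h
    have : N = 0 := by exact_mod_cast h
    subst this
    simp at hN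
    linarith
  have h2N : (2 * N : ℝ≥0∞) ≠ 0 := mul_ne_zero two_ne_zero hN0
  have h2N' : (2 * N : ℝ≥0∞) ≠ ∞ := ENNReal.mul_ne_top (by simp) (ENNReal.natCast_ne_top N)
  refine ⟨(2 * N)⁻¹, ENNReal.inv_ne_zero.2 h2N', ENNReal.inv_ne_top.2 h2N, fun n hn z₀ => ?_⟩
  have hz₀ : ‖(z₀ : EuclideanSpace ℝ (Fin n))‖ = 1 := norm_eq_of_mem_sphere z₀
  have : Nontrivial (EuclideanSpace ℝ (Fin n)) :=
    ⟨z₀, 0, fun h => by rw [h, norm_zero] at hz₀; exact zero_ne_one hz₀⟩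
  have hslab := volume_closedBall_le_slab hz₀ hε hN
  set Q := {y : EuclideanSpace ℝ (Fin n) |
    ‖y‖ ≤ σ ∧ 0 ≤ inner ℝ (z₀ : EuclideanSpace ℝ (Fin n)) y ∧
      inner ℝ (z₀ : EuclideanSpace ℝ (Fin n)) y ≤ ε} with hQ
  -- The point `0` occurs only for `θ = π / 2`, where `cos θ = 0`.
  have hsub : (Real.cos θ • (z₀ : EuclideanSpace ℝ (Fin n))) +ᵥ Q ⊆ cone (cap z₀ θ) ∪ {0} := by
    rintro _ ⟨y, ⟨hy, hy0, hy1⟩, rfl⟩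
    simp only [vadd_eq_add]
    set x := Real.cos θ • (z₀ : EuclideanSpace ℝ (Fin n)) + y with hx
    by_cases hx0 : x = 0
    · exact Or.inr hx0
    have hxpos : 0 < ‖x‖ := norm_pos_iff.2 hx0
    have hx1 : ‖x‖ < 1 := by
      have : ‖x‖ ^ 2 < 1 := by
        rw [hx, norm_add_sq_real, norm_smul, hz₀, inner_smul_left, mul_one, Real.norm_eq_abs,
          sq_abs, conj_trivial]
        have h1 : Real.cos θ * inner ℝ (z₀ : EuclideanSpace ℝ (Fin n)) y ≤ ε :=
          (mul_le_of_le_one_left hy0 ha1).trans hy1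
        have h2 : ‖y‖ ^ 2 ≤ σ ^ 2 := pow_le_pow_left₀ (norm_nonneg _) hy 2
        linarith
      exact (sq_lt_one_iff₀ hxpos.le).1 this
    have hin : Real.cos θ ≤ inner ℝ (z₀ : EuclideanSpace ℝ (Fin n)) x := by
      rw [hx, inner_add_right, inner_smul_right, real_inner_self_eq_norm_sq, hz₀]
      linarith
    refine Or.inl (mem_cone.2 ⟨‖x‖, hxpos, hx1, ⟨‖x‖⁻¹ • x, ?_⟩, ?_, ?_⟩)
    · simp [norm_smul, hxpos.ne']
    · change Real.arccos _ ≤ θ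
      rw [← Real.arccos_cos hθ₀.le (by linarith [Real.pi_pos])]
      refine Real.arccos_le_arccos ?_
      rw [inner_smul_right, inv_mul_eq_div, le_div_iff₀ hxpos]
      exact (mul_le_of_le_one_right ha hx1.le).trans hin
    · rw [smul_smul, mul_inv_cancel₀ hxpos.ne', one_smul]
  have hvol : volume Q ≤ volume (cone (cap z₀ θ)) := by
    calc volume Q = volume ((Real.cos θ • (z₀ : EuclideanSpace ℝ (Fin n))) +ᵥ Q) := by simp
      _ ≤ volume (cone (cap z₀ θ)) + volume {(0 : EuclideanSpace ℝ (Fin n))} :=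
        (measure_mono hsub).trans (measure_union_le _ _)
      _ = volume (cone (cap z₀ θ)) := by simp
  rw [uniform_apply hn (isClosed_cap z₀ θ).measurableSet, ENNReal.le_div_iff_mul_le
    (Or.inl (volume_ball_ne_zero n)) (Or.inl (volume_ball_ne_top n)), mul_right_comm,
    ← volume_closedBall n hσ₀.le, ← div_eq_mul_inv, ENNReal.div_le_iff_le_mul (Or.inl h2N)
    (Or.inl h2N'), mul_comm]
  exact hslab.trans (by gcongr)

/-! ### Concentration of the blowup -/

lemma blowup_mono {n : ℕ} (A : Set (Sphere n)) {ω₁ ω₂ : ℝ} (h : ω₁ ≤ ω₂) :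
    blowup A ω₁ ⊆ blowup A ω₂ := fun _ ⟨z, hz, hx⟩ => ⟨z, hz, hx.trans h⟩

end SphereBlowup

open SphereBlowup Set in
theorem propositionP (θ ω : ℝ) (hθ₀ : 0 < θ) (hθ₁ : θ ≤ Real.pi / 2)
    (hω : Real.pi / 2 - θ < ω)
    (A : (n : ℕ) → Set (SphereBlowup.Sphere n))
    (hA : ∀ n : ℕ, 1 ≤ n → SphereBlowup.HasEffectiveAngle (A n) θ) :
    Tendsto (fun n : ℕ => SphereBlowup.uniform n (SphereBlowup.blowup (A n) ω))
      atTop (𝓝 1) := by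
  have hpi := Real.pi_pos
  set ω' := min ω (Real.pi / 2) with hω'
  have hω'lo : Real.pi / 2 - θ < ω' := lt_min hω (by linarith)
  have hω'hi : ω' ≤ Real.pi / 2 := min_le_right _ _
  set κ := Real.cos ω' with hκdef
  have hκ : 0 ≤ κ := Real.cos_nonneg_of_mem_Icc ⟨by linarith, hω'hi⟩
  have hκθ : κ < Real.sin θ := by
    rw [← Real.cos_pi_div_two_sub]
    exact Real.cos_lt_cos_of_nonneg_of_le_pi (by linarith) (by linarith) hω'lo
  obtain ⟨σ, hκσ, hσθ⟩ := exists_between hκθ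
  have hσ : 0 < σ := hκ.trans_lt hκσ
  obtain ⟨c, hc0, hcT, hc⟩ := exists_le_uniform_cap hθ₀ hθ₁ hσ hσθ
  have hd : κ / σ < 1 := (div_lt_one hσ).2 hκσ
  have hd0 : 0 ≤ κ / σ := div_nonneg hκ hσ.le
  -- The squared radius is `1 - 2 p (1 - κ / σ) + O(p ^ 2)`, hence below `1` for this `p`.
  set p := (1 - κ / σ) / ((σ⁻¹) ^ 2 + 1) with hp
  have hD : 1 < (σ⁻¹) ^ 2 + 1 := lt_add_of_pos_left _ (by positivity)
  have hp₀ : 0 < p := div_pos (by linarith) (by linarith)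
  have hp₁ : p < 1 := (div_lt_one (by linarith)).2 (by linarith)
  have hpD : p * ((σ⁻¹) ^ 2 + 1) = 1 - κ / σ := div_mul_cancel₀ _ (by linarith)
  set R := √((p / σ) ^ 2 + (1 - p) ^ 2 + 2 * (p / σ) * (1 - p) * κ) with hR
  have hR1 : R < 1 := by
    rw [hR, Real.sqrt_lt' one_pos]
    have h : (p / σ) ^ 2 + (1 - p) ^ 2 + 2 * (p / σ) * (1 - p) * κ =
        1 + p * (p * ((σ⁻¹) ^ 2 + 1) - 2 * (1 - κ / σ)) - 2 * p ^ 2 * (κ / σ) := by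
      field_simp
      ring
    rw [h, hpD]
    have := mul_pos hp₀ (show 0 < 1 - κ / σ by linarith)
    have := mul_nonneg (sq_nonneg p) hd0
    linarith
  let B : (n : ℕ) → Set (Sphere n) := fun n =>
    {x | ∀ z ∈ A n, inner ℝ (z : EuclideanSpace ℝ (Fin n)) (x : EuclideanSpace ℝ (Fin n)) ≤ κ}
  have hBclosed : ∀ n, IsClosed (B n) := fun n => by
    have : B n = ⋂ z ∈ A n, {x : Sphere n |
        inner ℝ (z : EuclideanSpace ℝ (Fin n)) (x : EuclideanSpace ℝ (Fin n)) ≤ κ} := by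
      ext x
      simp [B]
    rw [this]
    exact isClosed_biInter fun z _ => isClosed_le (by fun_prop) continuous_const
  have hBlim : Tendsto (fun n => uniform n (B n)) atTop (𝓝 0) := by
    have hq : 0 < 1 - p := by linarith
    have hbound : ∀ n, 1 ≤ n → uniform n (B n) ^ (1 - p) ≤ ENNReal.ofReal R ^ n / c ^ p := by
      intro n hn
      obtain ⟨z₀, hz₀⟩ := hA n hn
      have hσn : ENNReal.ofReal σ ^ n ≠ 0 := by simp [hσ]
      have hcl : c ≤ uniform n (closure (A n)) / ENNReal.ofReal σ ^ n := by
        rw [ENNReal.le_div_iff_mul_le (Or.inl hσn) (Or.inl (by simp)), mul_comm]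
        exact (hc n hn z₀).trans (hz₀.symm.le.trans (measure_mono subset_closure))
      have hST : ∀ z ∈ closure (A n), ∀ w ∈ B n,
          inner ℝ (z : EuclideanSpace ℝ (Fin n)) (w : EuclideanSpace ℝ (Fin n)) ≤ κ := by
        intro z hz w hw
        have hcl : IsClosed {z : Sphere n |
            inner ℝ (z : EuclideanSpace ℝ (Fin n)) (w : EuclideanSpace ℝ (Fin n)) ≤ κ} :=
          isClosed_le (by fun_prop) continuous_const
        exact closure_minimal (fun z hz => hw z hz) hcl hz
      have := uniform_rpow_mul_uniform_rpow_le hn isClosed_closure.measurableSet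
        (hBclosed n).measurableSet hκ hσ hp₀ hp₁ hST
      rw [ENNReal.le_div_iff_mul_le (Or.inl (by simp [hc0, hcT]))
        (Or.inl (ENNReal.rpow_ne_top_of_nonneg hp₀.le hcT)), mul_comm]
      refine le_trans ?_ this
      gcongr
    have hlim : Tendsto (fun n : ℕ => ENNReal.ofReal R ^ n / c ^ p) atTop (𝓝 0) := by
      have := ENNReal.Tendsto.const_mul (a := (c ^ p)⁻¹)
        (ENNReal.tendsto_pow_atTop_nhds_zero_of_lt_one (r := ENNReal.ofReal R) (by simpa using hR1))
        (Or.inr (ENNReal.inv_ne_top.2 (by simp [hc0, hcT])))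
      simpa [ENNReal.div_eq_inv_mul] using this
    have hpow : Tendsto (fun n => uniform n (B n) ^ (1 - p)) atTop (𝓝 0) :=
      tendsto_of_tendsto_of_tendsto_of_le_of_le' tendsto_const_nhds hlim
        (Eventually.of_forall fun _ => zero_le)
        (eventually_atTop.2 ⟨1, hbound⟩)
    have := ((ENNReal.continuous_rpow_const (y := (1 - p)⁻¹)).tendsto 0).comp hpow
    simpa [Function.comp_def, ENNReal.rpow_rpow_inv hq.ne',
      ENNReal.zero_rpow_of_pos (inv_pos.2 hq)] using this
  have hlow : ∀ n, 1 ≤ n → 1 - uniform n (B n) ≤ uniform n (blowup (A n) ω) := by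
    intro n hn
    have := isProbabilityMeasure_uniform hn
    rw [← prob_compl_eq_one_sub (hBclosed n).measurableSet]
    refine measure_mono fun x hx => blowup_mono (A n) (min_le_left ω (Real.pi / 2)) ?_
    simp only [B, mem_compl_iff, mem_ofPred_eq, not_forall, not_le] at hx
    obtain ⟨z, hz, hzx⟩ := hx
    refine ⟨z, hz, ?_⟩
    rw [← hω', ← Real.arccos_cos (x := ω') (by linarith) (by linarith)]
    exact Real.arccos_le_arccos hzx.le
  refine tendsto_of_tendsto_of_tendsto_of_le_of_le' (g := fun n => 1 - uniform n (B n)) ?_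
    tendsto_const_nhds (eventually_atTop.2 ⟨1, hlow⟩) (eventually_atTop.2 ⟨1, fun n hn => ?_⟩)
  · simpa using ENNReal.Tendsto.sub tendsto_const_nhds hBlim (Or.inl ENNReal.one_ne_top)
  · have := isProbabilityMeasure_uniform hn
    exact prob_le_one
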